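/- Let $(X_t)_{t\ge 0}$ be a real-valued Lévy process on a probability space $(\Omega,\mathcal F,P)$ with characteristic triplet $(\bar b,\sigma,\nu)$, where $\bar b\in\mathbb R$, $\sigma\ge 0$ and $\nu$ is a $\sigma$-finite Borel measure on $\mathbb R$ with $\int \frac{x^2}{1+x^2}\,\nu(dx)<\infty$; that is, for all $t\ge0$ and $u\in\mathbb R$, $$E\big[e^{iuX_t}\big]=\exp\Big(t\Big(iu\bar b-\tfrac{\sigma^2}{2}u^2+\int_{\mathbb R}\big(e^{iux}-1-\tfrac{iux}{1+x^2}\big)\,\nu(dx)\Big)\Big).$$ Let $\mathcal M(\mathbb R)$ be the set of all finite Borel measures on $\mathbb R$. For $b\in\mathbb R$ and $\mu\in\mathcal M(\mathbb R)$ put $$\phi(u;b,\mu)=\exp\Big(iub+\int_{\mathbb R}\frac{(e^{iux}-1)(1+x^2)-iux}{x^2}\,\mu(dx)\Big),\qquad u\in\mathbb R,$$ where the integrand is extended continuously to $x=0$ by the value $-u^2/2$. Put $$\bar\nu_\sigma(dx)=\sigma^2\,\delta_0(dx)+\frac{x^2}{1+x^2}\,\nu(dx)\in\mathcal M(\mathbb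 R),\qquad \widehat\phi_n(u)=\frac1n\sum_{k=1}^n e^{iu(X_k-X_{k-1})}\quad(n\ge 1).$$ Let $d$ be a distance on the set of characteristic functions of Borel probability measures on $\mathbb R$: $d$ takes values in $[0,\infty]$, is symmetric, satisfies $d(\phi,\phi)=0$ and the triangle inequality (any metric is allowed; neither finiteness nor separation of points is required). Assume that 1. $\lim_{n\to\infty} d\big(\widehat\phi_n,\phi(\cdot;\bar b,\bar\nu_\sigma)\big)=0$ $P$-almost surely; 2. for all sequences $(b_n)$ in $\mathbb R$ and $(\mu_n)$ in $\mathcal M(\mathbb R)$: if $d\big(\phi(\cdot;b_n,\mu_n),\phi(\cdot;\bar b,\bar\nu_\sigma)\big)\to0$, then $\int_s^t\phi(u;b_n,\mu_n)\,du\to\int_s^t\phi(u;\bar b,\bar\nu_\sigma)\,du$ for all $s,t\in\mathbb R$. Let $(\delta_n)_{n\ge1}$ be positive reals with $\delta_n\to0$, and let $\widehat b_n$ (with values in $\mathbb R$) and $\widehat\nu_{\sigma,n}$ (with values in $\mathcal M(\mathbb R)$) be functions on $\Omega$ such that, $P$-almost surely, for all $n\ge1$, $$d\big(\widehat\phi_n,\phi(\cdot;\widehat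 b_n,\widehat\nu_{\sigma,n})\big)\le\inf_{\tilde b\in\mathbb R,\ \tilde\nu\in\mathcal M(\mathbb R)}d\big(\widehat\phi_n,\phi(\cdot;\tilde b,\tilde\nu)\big)+\delta_n .$$ Then $P$-almost surely, as $n\to\infty$, $\widehat b_n\to\bar b$ and $\widehat\nu_{\sigma,n}$ converges weakly to $\bar\nu_\sigma$. -/

import Mathlib

open MeasureTheory ProbabilityTheory Filter Topology
open scoped NNReal ENNReal

/-- `ν` is a jump measure: a `σ`-finite Borel measure on `ℝ` with `∫ x²/(1+x²) ν(dx) < ∞`.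
A possible atom at `0` is irrelevant: it contributes neither to the characteristic exponent nor to
the measure `x²/(1+x²) ν(dx)`. -/
structure IsJumpMeasure (ν : Measure ℝ) : Prop where
  sigmaFinite : SigmaFinite ν
  lintegral_lt_top : ∫⁻ x, ENNReal.ofReal (x ^ 2 / (1 + x ^ 2)) ∂ν < ∞

/-- The characteristic exponent of the triplet `(b, σ, ν)`:
`Ψ(u) = iub - σ²u²/2 + ∫ (e^{iux} - 1 - iux/(1+x²)) ν(dx)`. -/
noncomputable def tripletExponent (b σ : ℝ) (ν : Measure ℝ) (u : ℝ) : ℂ :=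
  Complex.I * u * b - (σ : ℂ) ^ 2 / 2 * (u : ℂ) ^ 2 +
    ∫ x : ℝ, (Complex.exp (Complex.I * u * x) - 1 - Complex.I * u * x / (1 + (x : ℂ) ^ 2)) ∂ν

/-- The finite Borel measure `ν_σ(dx) = σ² δ₀(dx) + x²/(1+x²) ν(dx)`. -/
noncomputable def nuSigma (σ : ℝ) (ν : Measure ℝ) (hν : IsJumpMeasure ν) : FiniteMeasure ℝ :=
  ⟨ENNReal.ofReal (σ ^ 2) • Measure.dirac 0 +
      ν.withDensity (fun x => ENNReal.ofReal (x ^ 2 / (1 + x ^ 2))), by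
    have h1 : IsFiniteMeasure (ν.withDensity (fun x => ENNReal.ofReal (x ^ 2 / (1 + x ^ 2)))) :=
      isFiniteMeasure_withDensity hν.lintegral_lt_top.ne
    have h2 : IsFiniteMeasure (ENNReal.ofReal (σ ^ 2) • Measure.dirac (0 : ℝ)) :=
      Measure.smul_finite _ ENNReal.ofReal_ne_top
    infer_instance⟩

/-- The kernel `((e^{iux} - 1)(1+x²) - iux)/x²`, with its continuous extension `-u²/2` at `x = 0`. -/
noncomputable def levyKernel (u x : ℝ) : ℂ :=
  if x = 0 then -((u : ℂ) ^ 2 / 2)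
  else ((Complex.exp (Complex.I * u * x) - 1) * (1 + (x : ℂ) ^ 2) - Complex.I * u * x) /
    (x : ℂ) ^ 2

/-- The characteristic function `φ(u; b, μ) = exp (iub + ∫ ((e^{iux} - 1)(1+x²) - iux)/x² μ(dx))`
for `b ∈ ℝ` and a finite Borel measure `μ` on `ℝ`. -/
noncomputable def levyPhi (b : ℝ) (μ : FiniteMeasure ℝ) (u : ℝ) : ℂ :=
  Complex.exp (Complex.I * u * b + ∫ x, levyKernel u x ∂(μ : Measure ℝ))

/-- `X` is a (one-dimensional) Lévy process under `P`: it starts at `0`, has independent and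
stationary increments, and is stochastically continuous. (No path regularity is required; in
particular every Lévy process with càdlàg paths is covered.) -/
structure IsLevyProcess {Ω : Type*} [MeasurableSpace Ω] (P : Measure Ω) (X : ℝ≥0 → Ω → ℝ) :
    Prop where
  aemeasurable : ∀ t, AEMeasurable (X t) P
  start : ∀ᵐ ω ∂P, X 0 ω = 0
  indepIncrements : HasIndepIncrements X P
  stationaryIncrements : ∀ s t : ℝ≥0,
    P.map (fun ω => X (s + t) ω - X s ω) = P.map (X t)
  stochContinuous : ∀ t : ℝ≥0, TendstoInMeasure P X (𝓝 t) (X t)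

/-- The Lévy process `X` has characteristic triplet `(b, σ, ν)`:
`E[exp(iuX_t)] = exp(t Ψ(u; b, σ, ν))` for all `t ≥ 0` and `u ∈ ℝ`. -/
def HasTriplet {Ω : Type*} [MeasurableSpace Ω] (P : Measure Ω) (X : ℝ≥0 → Ω → ℝ)
    (b σ : ℝ) (ν : Measure ℝ) : Prop :=
  ∀ (t : ℝ≥0) (u : ℝ), ∫ ω, Complex.exp (Complex.I * u * X t ω) ∂P =
    Complex.exp ((t : ℝ) * tripletExponent b σ ν u)

/-- The empirical characteristic function of the increments over `[k, k+1]`, `k < n`: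
`n⁻¹ ∑_{k=1}^n e^{iu(X_k - X_{k-1})}`. It is only used for `n ≥ 1`. -/
noncomputable def empiricalCharFun {Ω : Type*} (X : ℝ≥0 → Ω → ℝ) (n : ℕ) (ω : Ω) (u : ℝ) : ℂ :=
  (1 / (n : ℂ)) * ∑ k ∈ Finset.range n,
    Complex.exp (Complex.I * u * ((X ((k : ℝ≥0) + 1) ω - X (k : ℝ≥0) ω : ℝ) : ℂ))

/-- The set of characteristic functions of Borel probability measures on `ℝ`. -/
def charFunctions : Set (ℝ → ℂ) :=
  {φ | ∃ μ : Measure ℝ, IsProbabilityMeasure μ ∧ φ = charFun μ}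

/-- `d` is a distance on the set `S`, possibly with the value `∞` and possibly vanishing on pairs of
distinct points. Every metric on `S` is of this form. -/
structure IsDistanceOn {α : Type*} (S : Set α) (d : α → α → ℝ≥0∞) : Prop where
  self : ∀ x ∈ S, d x x = 0
  symm : ∀ x ∈ S, ∀ y ∈ S, d x y = d y x
  triangle : ∀ x ∈ S, ∀ y ∈ S, ∀ z ∈ S, d x z ≤ d x y + d y z

/-! The probabilistic part is a triangle inequality. The fitted function is at most `δ n` further
from the empirical one than the true function is, so its distance to the true function is at most
twice the empirical error plus `δ n`, which tends to zero almost surely. The second assumption on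
`d` turns this into convergence of integrals over intervals. What remains is deterministic:
`tendsto_of_tendsto_integral_levyPhi`.

Integrals of characteristic functions near `0` control tails, so the laws are tight. Tightness gives
a common modulus of continuity up to a small error, and convergence of interval averages becomes
locally uniform convergence (`tendstoLocallyUniformly_charFun_of_tendsto_integral`). The exponents
are continuous and vanish at `0`, so they are the logarithms that stay on the principal branch when
compared with the limit, and they converge too
(`eventually_norm_sub_lt_of_tendstoLocallyUniformly_exp`).

Subtracting from an exponent its mean over `[u - 1, u + 1]` removes the drift and leaves the Fourier
transform of `w(x) μ(dx)`, where `w(x) = (1 - sin x / x)(1 + x²)/x²` (`levyExponent_sub_average`).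
Hence the weighted measures converge weakly. As `w` is continuous and bounded away from zero, it can
be divided out. The drift is then what is left of the exponent at `u = 1`. -/

/-! ### The Lévy kernel: continuity and bounds -/

/-- The entire function `(e^{iy} - 1 - iy) / y²`, written as an integral. -/
noncomputable def expRemainderQuotient (y : ℝ) : ℂ :=
  -∫ t in (0 : ℝ)..1, (1 - (t : ℂ)) * Complex.exp (Complex.I * t * y)

lemma sq_mul_expRemainderQuotient (y : ℝ) :
    (y : ℂ) ^ 2 * expRemainderQuotient y =
      Complex.exp (Complex.I * y) - 1 - Complex.I * y := by
  rcases eq_or_ne y 0 with rfl | hy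
  · simp
  have hy' : (y : ℂ) ≠ 0 := by exact_mod_cast hy
  have hd : ∀ t ∈ Set.uIcc (0 : ℝ) 1, HasDerivAt
      (fun t : ℝ => (1 - (t : ℂ)) * (Complex.exp (Complex.I * t * y) / (Complex.I * y))
        + Complex.exp (Complex.I * t * y) / (Complex.I * y) ^ 2)
      ((1 - (t : ℂ)) * Complex.exp (Complex.I * t * y)) t := by
    intro t _
    have h1 : HasDerivAt (fun t : ℝ => (t : ℂ)) 1 t := Complex.ofRealCLM.hasDerivAt
    have h2 : HasDerivAt (fun t : ℝ => Complex.exp (Complex.I * t * y))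
        (Complex.exp (Complex.I * t * y) * (Complex.I * 1 * y)) t :=
      ((h1.const_mul Complex.I).mul_const (y : ℂ)).cexp
    convert! ((h1.const_sub 1).mul (h2.div_const (Complex.I * y))).add
      (h2.div_const ((Complex.I * y) ^ 2)) using 1
    field_simp
    ring
  have := intervalIntegral.integral_eq_sub_of_hasDerivAt hd
    (Continuous.intervalIntegrable (by fun_prop) _ _)
  rw [expRemainderQuotient, this]
  simp only [Complex.ofReal_one, Complex.ofReal_zero, mul_zero, zero_mul, Complex.exp_zero,
    mul_one, mul_pow, Complex.I_sq]
  field_simp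
  linear_combination (y : ℂ) * Complex.I_sq

lemma continuous_expRemainderQuotient : Continuous expRemainderQuotient := by
  unfold expRemainderQuotient
  refine (intervalIntegral.continuous_parametric_intervalIntegral_of_continuous' ?_ 0 1).neg
  fun_prop

lemma expRemainderQuotient_zero : expRemainderQuotient 0 = -(1 / 2) := by
  have : (∫ t in (0 : ℝ)..1, (1 - (t : ℂ))) = ((∫ t in (0 : ℝ)..1, (1 - t) : ℝ) : ℂ) := by
    rw [← intervalIntegral.integral_ofReal]; simp
  have h2 : (∫ t in (0 : ℝ)..1, (1 - t)) = 1 / 2 := by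
    rw [intervalIntegral.integral_sub (by simp) (by simp)]; norm_num
  simp [expRemainderQuotient, this, h2]

lemma norm_expRemainderQuotient_le (y : ℝ) : ‖expRemainderQuotient y‖ ≤ 1 := by
  rw [expRemainderQuotient, norm_neg]
  refine (intervalIntegral.norm_integral_le_of_norm_le_const (C := 1) fun t ht => ?_).trans
    (by simp)
  rw [Set.uIoc_of_le zero_le_one] at ht
  have : Complex.I * t * y = ((t * y : ℝ) : ℂ) * Complex.I := by push_cast; ring
  rw [norm_mul, this, Complex.norm_exp_ofReal_mul_I, mul_one, ← Complex.ofReal_one,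
    ← Complex.ofReal_sub, Complex.norm_real, Real.norm_eq_abs, abs_le]
  constructor <;> linarith [ht.1, ht.2]

/-- Both summands are jointly continuous with explicit bounds, so continuity and domination of the
kernel need no separate treatment of `x = 0`. -/
lemma levyKernel_eq (u x : ℝ) :
    levyKernel u x = (u : ℂ) ^ 2 * expRemainderQuotient (u * x) +
      (Complex.exp (Complex.I * u * x) - 1) := by
  rcases eq_or_ne x 0 with rfl | hx
  · simp [levyKernel, expRemainderQuotient_zero]; ring
  have hx' : (x : ℂ) ≠ 0 := by exact_mod_cast hx
  have h := sq_mul_expRemainderQuotient (u * x)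
  push_cast at h
  have h' : (u : ℂ) ^ 2 * expRemainderQuotient (u * x) =
      (Complex.exp (Complex.I * u * x) - 1 - Complex.I * u * x) / (x : ℂ) ^ 2 := by
    rw [eq_div_iff (pow_ne_zero 2 hx'), mul_assoc Complex.I, ← h]; ring
  rw [h', levyKernel, if_neg hx]
  field_simp
  ring

lemma continuous_uncurry_levyKernel : Continuous (Function.uncurry levyKernel) := by
  have : Function.uncurry levyKernel = fun p : ℝ × ℝ =>
      (p.1 : ℂ) ^ 2 * expRemainderQuotient (p.1 * p.2) +
        (Complex.exp (Complex.I * p.1 * p.2) - 1) := by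
    ext p; exact levyKernel_eq p.1 p.2
  rw [this]
  have := continuous_expRemainderQuotient
  fun_prop

lemma continuous_levyKernel_right (u : ℝ) : Continuous (levyKernel u) :=
  continuous_uncurry_levyKernel.comp (by fun_prop : Continuous fun x : ℝ => (u, x))

lemma norm_cexp_I_mul_mul (u x : ℝ) : ‖Complex.exp (Complex.I * u * x)‖ = 1 := by
  have : Complex.I * u * x = ((u * x : ℝ) : ℂ) * Complex.I := by push_cast; ring
  rw [this, Complex.norm_exp_ofReal_mul_I]

lemma norm_levyKernel_le (u x : ℝ) : ‖levyKernel u x‖ ≤ u ^ 2 + 2 := by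
  rw [levyKernel_eq]
  refine (norm_add_le _ _).trans (add_le_add ?_ ?_)
  · rw [norm_mul, norm_pow, Complex.norm_real, Real.norm_eq_abs, sq_abs]
    exact mul_le_of_le_one_right (sq_nonneg u) (norm_expRemainderQuotient_le _)
  · refine (norm_sub_le _ _).trans ?_
    rw [norm_cexp_I_mul_mul, norm_one]; norm_num

lemma integrable_levyKernel (u : ℝ) (μ : Measure ℝ) [IsFiniteMeasure μ] :
    Integrable (levyKernel u) μ :=
  .of_bound (continuous_levyKernel_right u).aestronglyMeasurable (u ^ 2 + 2)
    (.of_forall (norm_levyKernel_le u))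

/-- The exponent of `levyPhi b μ`. -/
noncomputable def levyExponent (b : ℝ) (μ : FiniteMeasure ℝ) (u : ℝ) : ℂ :=
  Complex.I * u * b + ∫ x, levyKernel u x ∂(μ : Measure ℝ)

lemma levyExponent_zero (b : ℝ) (μ : FiniteMeasure ℝ) : levyExponent b μ 0 = 0 := by
  simp [levyExponent, levyKernel_eq]

lemma continuous_integral_levyKernel (μ : Measure ℝ) [IsFiniteMeasure μ] :
    Continuous fun u => ∫ x, levyKernel u x ∂μ := by
  refine continuous_iff_continuousAt.2 fun u₀ => ?_
  refine continuousAt_of_dominated (bound := fun _ => (|u₀| + 1) ^ 2 + 2)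
    (.of_forall fun u => (continuous_levyKernel_right u).aestronglyMeasurable) ?_
    (integrable_const _) (.of_forall fun x => ?_)
  · filter_upwards [Metric.ball_mem_nhds u₀ one_pos] with u hu
    refine .of_forall fun x => (norm_levyKernel_le u x).trans ?_
    have : |u| ≤ |u₀| + 1 := by
      have h1 : |u - u₀| < 1 := by simpa [Real.dist_eq] using hu
      have h2 := abs_add_le (u - u₀) u₀
      simp only [sub_add_cancel] at h2
      linarith
    have := pow_le_pow_left₀ (abs_nonneg u) this 2
    rw [sq_abs] at this
    linarith
  · exact (continuous_uncurry_levyKernel.comp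
      (by fun_prop : Continuous fun u : ℝ => (u, x))).continuousAt

lemma continuous_levyExponent (b : ℝ) (μ : FiniteMeasure ℝ) :
    Continuous (levyExponent b μ) := by
  unfold levyExponent
  have := continuous_integral_levyKernel (μ : Measure ℝ)
  fun_prop

/-! ### Removing the drift by averaging the exponent -/

/-- The continuous function `(1 - sin x / x)(1 + x²)/x²`. -/
noncomputable def levyWeight (x : ℝ) : ℝ :=
  -(1 / 2) * ∫ s in (-1 : ℝ)..1, (levyKernel s x).re

lemma continuous_levyWeight : Continuous levyWeight := by
  unfold levyWeight
  refine Continuous.mul (by fun_prop)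
    (intervalIntegral.continuous_parametric_intervalIntegral_of_continuous'
      (f := fun x s => (levyKernel s x).re) ?_ _ _)
  exact Complex.continuous_re.comp
    (continuous_uncurry_levyKernel.comp continuous_swap)

lemma integral_exp_I_mul (x : ℝ) (hx : x ≠ 0) :
    ∫ s in (-1 : ℝ)..1, Complex.exp (Complex.I * s * x) = 2 * (Real.sin x / x : ℝ) := by
  have hx' : (x : ℂ) ≠ 0 := by exact_mod_cast hx
  have h : ∀ s : ℝ, Complex.I * s * x = (Complex.I * x) * s := fun s => by ring
  simp_rw [h]
  rw [integral_exp_mul_complex (by simp [hx'])]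
  push_cast
  rw [Complex.sin]
  field_simp
  simp only [Complex.I_sq]
  ring_nf

/-- A symmetric average preserves terms affine in `u`, so these cancel, while it multiplies
`e^{iux}` by `sin x / x`. At `x = 0` the kernel is quadratic in `u`, and `1/6` is half the mean of
`s²` over `[-1, 1]`. -/
lemma levyKernel_sub_average (u x : ℝ) :
    levyKernel u x - (1 / 2) * ∫ s in (-1 : ℝ)..1, levyKernel (u + s) x =
      Complex.exp (Complex.I * u * x) *
        (if x = 0 then 1 / 6 else ((1 - Real.sin x / x) * (1 + x ^ 2) / x ^ 2 : ℝ)) := by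
  rcases eq_or_ne x 0 with rfl | hx
  · have h : ∀ s : ℝ, levyKernel (u + s) 0 = ((-((u + s) ^ 2 / 2) : ℝ) : ℂ) := fun s => by
      simp [levyKernel]
    simp_rw [h]
    rw [intervalIntegral.integral_ofReal]
    simp [levyKernel, intervalIntegral.integral_comp_add_left (fun s => s ^ 2)]
    ring
  have hx' : (x : ℂ) ≠ 0 := by exact_mod_cast hx
  have h : ∀ s : ℝ, levyKernel (u + s) x =
      (Complex.exp (Complex.I * u * x) * (1 + (x : ℂ) ^ 2) / (x : ℂ) ^ 2) *
        Complex.exp (Complex.I * s * x) -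
      ((1 + (x : ℂ) ^ 2) / (x : ℂ) ^ 2 + Complex.I * u / x) - (Complex.I / x) * s := fun s => by
    have : Complex.I * ((u + s : ℝ) : ℂ) * x = Complex.I * u * x + Complex.I * s * x := by
      push_cast; ring
    rw [levyKernel, if_neg hx, this, Complex.exp_add]
    field_simp
    ring
  have hs : ∫ s in (-1 : ℝ)..1, (s : ℂ) = 0 := by
    rw [intervalIntegral.integral_ofReal]; simp
  simp_rw [h]
  rw [intervalIntegral.integral_sub (Continuous.intervalIntegrable (by fun_prop) _ _)
      (Continuous.intervalIntegrable (by fun_prop) _ _),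
    intervalIntegral.integral_sub (Continuous.intervalIntegrable (by fun_prop) _ _)
      (Continuous.intervalIntegrable (by fun_prop) _ _),
    intervalIntegral.integral_const_mul, intervalIntegral.integral_const_mul, hs,
    integral_exp_I_mul x hx, levyKernel, if_neg hx, if_neg hx]
  simp
  field_simp
  ring

/-- This is the case `u = 0` of `levyKernel_sub_average`. The integral form gives continuity across
`0`; the closed form gives positivity and the lower bound. -/
lemma levyWeight_eq (x : ℝ) :
    levyWeight x = if x = 0 then 1 / 6 else (1 - Real.sin x / x) * (1 + x ^ 2) / x ^ 2 := by
  have h := levyKernel_sub_average 0 x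
  have h0 : levyKernel 0 x = 0 := by simp [levyKernel_eq]
  simp only [h0, zero_add, Complex.ofReal_zero, mul_zero, zero_mul, Complex.exp_zero,
    one_mul, zero_sub] at h
  have hint : ∫ s in (-1 : ℝ)..1, (levyKernel s x).re =
      (∫ s in (-1 : ℝ)..1, levyKernel s x).re :=
    Complex.reCLM.intervalIntegral_comp_comm (Continuous.intervalIntegrable
      (continuous_uncurry_levyKernel.comp (by fun_prop : Continuous fun s : ℝ => (s, x))) _ _)
  have h2 := congrArg Complex.re h
  rw [levyWeight, hint]
  simp only [Complex.neg_re, Complex.mul_re] at h2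
  norm_num at h2
  split_ifs at h2 ⊢ with hx <;> linarith

lemma levyKernel_sub_average_eq (u x : ℝ) :
    levyKernel u x - (1 / 2) * ∫ s in (-1 : ℝ)..1, levyKernel (u + s) x =
      Complex.exp (Complex.I * u * x) * levyWeight x := by
  rw [levyKernel_sub_average, levyWeight_eq]

lemma levyWeight_pos (x : ℝ) : 0 < levyWeight x := by
  rw [levyWeight_eq]
  split_ifs with hx
  · norm_num
  have : Real.sin x / x < 1 := by
    rcases lt_or_gt_of_ne hx with h | h
    · rw [div_lt_one_of_neg h]
      have := Real.sin_lt (neg_pos.2 h)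
      rw [Real.sin_neg] at this; linarith
    · rw [div_lt_one h]; exact Real.sin_lt h
  have := sub_pos.2 this
  positivity

lemma exists_le_levyWeight : ∃ c > 0, ∀ x, c ≤ levyWeight x := by
  -- On `[-2, 2]` compactness applies; outside, `|sin x / x| ≤ 1/2` and `(1 + x²)/x² ≥ 1` give the
  -- bound `1/2`.
  obtain ⟨y, -, hy⟩ := isCompact_Icc.exists_isMinOn (s := Set.Icc (-2 : ℝ) 2) ⟨0, by simp⟩
    continuous_levyWeight.continuousOn
  refine ⟨min (levyWeight y) (1 / 2), lt_min (levyWeight_pos y) (by norm_num), fun x => ?_⟩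
  by_cases hx : x ∈ Set.Icc (-2 : ℝ) 2
  · exact (min_le_left _ _).trans (hy hx)
  refine (min_le_right _ _).trans ?_
  have h2 : 2 < |x| := by
    by_contra! h; exact hx (abs_le.1 h)
  have hx0 : x ≠ 0 := by rintro rfl; simp at h2; linarith
  rw [levyWeight_eq, if_neg hx0]
  have h3 : Real.sin x / x ≤ 1 / 2 := by
    refine (le_abs_self _).trans ?_
    rw [abs_div, div_le_iff₀ (by linarith)]
    linarith [Real.abs_sin_le_one x]
  have h4 : 0 < x ^ 2 := by positivity
  rw [le_div_iff₀ h4]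
  nlinarith

lemma levyWeight_le (x : ℝ) : levyWeight x ≤ 3 := by
  have : ‖∫ s in (-1 : ℝ)..1, (levyKernel s x).re‖ ≤ 3 * |1 - (-1)| := by
    refine intervalIntegral.norm_integral_le_of_norm_le_const fun s hs => ?_
    rw [Set.uIoc_of_le (by norm_num)] at hs
    refine (Complex.abs_re_le_norm _).trans ((norm_levyKernel_le s x).trans ?_)
    nlinarith [hs.1, hs.2]
  rw [Real.norm_eq_abs] at this
  norm_num at this
  rw [levyWeight]
  linarith [(abs_le.1 this).1]

/-- Averaging the exponent removes the drift and leaves a Fourier transform of a finite measure. -/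
lemma levyExponent_sub_average (b : ℝ) (μ : FiniteMeasure ℝ) (u : ℝ) :
    levyExponent b μ u - (1 / 2) * ∫ s in (-1 : ℝ)..1, levyExponent b μ (u + s) =
      ∫ x, Complex.exp (Complex.I * u * x) * levyWeight x ∂(μ : Measure ℝ) := by
  have hcont : Continuous fun p : ℝ × ℝ => levyKernel (u + p.1) p.2 :=
    continuous_uncurry_levyKernel.comp (by fun_prop : Continuous fun p : ℝ × ℝ => (u + p.1, p.2))
  have hswap : ∫ s in (-1 : ℝ)..1, ∫ x, levyKernel (u + s) x ∂(μ : Measure ℝ) =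
      ∫ x, (∫ s in (-1 : ℝ)..1, levyKernel (u + s) x) ∂(μ : Measure ℝ) := by
    refine intervalIntegral_integral_swap (f := fun s x => levyKernel (u + s) x) ?_
    have hg : Continuous fun s : ℝ => (u + s) ^ 2 + 2 := by fun_prop
    refine Integrable.mono' (((hg.intervalIntegrable (-1) 1).def').comp_fst (μ : Measure ℝ))
      hcont.aestronglyMeasurable (.of_forall fun p => ?_)
    exact norm_levyKernel_le (u + p.1) p.2
  have hdrift : ∫ s in (-1 : ℝ)..1, Complex.I * (u + s : ℝ) * b = 2 * (Complex.I * u * b) := by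
    have h : ∀ s : ℝ, Complex.I * (u + s : ℝ) * b =
        Complex.I * u * b + (Complex.I * b) * s := fun s => by push_cast; ring
    have hs : ∫ s in (-1 : ℝ)..1, (s : ℂ) = 0 := by
      rw [intervalIntegral.integral_ofReal]; simp
    simp_rw [h]
    rw [intervalIntegral.integral_add (by simp)
      (Continuous.intervalIntegrable (by fun_prop) _ _), intervalIntegral.integral_const_mul (Complex.I * b), hs]
    simp
    ring
  have hci : Continuous fun s : ℝ => ∫ x, levyKernel (u + s) x ∂(μ : Measure ℝ) :=
    (continuous_integral_levyKernel (μ : Measure ℝ)).comp (continuous_const_add u)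
  simp_rw [← levyKernel_sub_average_eq]
  rw [integral_sub (integrable_levyKernel u _), integral_const_mul]
  · rw [← hswap]
    simp only [levyExponent]
    rw [intervalIntegral.integral_add (Continuous.intervalIntegrable (by fun_prop) _ _)
      (hci.intervalIntegrable _ _), hdrift]
    ring
  · have h : (fun x => (1 / 2 : ℂ) * ∫ s in (-1 : ℝ)..1, levyKernel (u + s) x) = fun x =>
        levyKernel u x - Complex.exp (Complex.I * u * x) * levyWeight x := by
      ext x; rw [← levyKernel_sub_average_eq]; ring
    rw [h]
    refine (integrable_levyKernel u _).sub (.of_bound ?_ 3 (.of_forall fun x => ?_))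
    · have := continuous_levyWeight
      exact Continuous.aestronglyMeasurable (by fun_prop)
    · rw [norm_mul, norm_cexp_I_mul_mul, one_mul, Complex.norm_real, Real.norm_eq_abs,
        abs_of_pos (levyWeight_pos x)]
      exact levyWeight_le x

/-! ### Lévy–Khintchine functions are characteristic functions -/

lemma charFunctions_mul {f g : ℝ → ℂ} (hf : f ∈ charFunctions) (hg : g ∈ charFunctions) :
    (fun u => f u * g u) ∈ charFunctions := by
  obtain ⟨μ, hμ, rfl⟩ := hf
  obtain ⟨ν, hν, rfl⟩ := hg
  exact ⟨μ ∗ ν, inferInstance, funext fun u => (charFun_conv u).symm⟩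

lemma exp_drift_mem_charFunctions (b : ℝ) :
    (fun u : ℝ => Complex.exp (Complex.I * u * b)) ∈ charFunctions := by
  refine ⟨Measure.dirac b, inferInstance, funext fun u => ?_⟩
  rw [charFun_dirac]
  congr 1
  simp
  ring

lemma charFunctions_pow {f : ℝ → ℂ} (hf : f ∈ charFunctions) (n : ℕ) :
    (fun u => f u ^ n) ∈ charFunctions := by
  induction n with
  | zero => simpa using exp_drift_mem_charFunctions 0
  | succ n ih => simpa only [pow_succ] using charFunctions_mul ih hf

/-- A pointwise limit of characteristic functions which is continuous at `0` is a
characteristic function. -/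
lemma charFunctions_of_tendsto {f : ℕ → ℝ → ℂ} {g : ℝ → ℂ}
    (hf : ∀ᶠ n in atTop, f n ∈ charFunctions) (hg : ContinuousAt g 0)
    (h : ∀ u, Tendsto (fun n => f n u) atTop (𝓝 (g u))) : g ∈ charFunctions := by
  obtain ⟨N, hN⟩ := eventually_atTop.1 hf
  choose μ hμ hμf using fun n => hN (n + N) (Nat.le_add_left N n)
  have h' : ∀ u, Tendsto (fun n => charFun (μ n) u) atTop (𝓝 (g u)) := fun u => by
    simpa only [hμf] using (tendsto_add_atTop_iff_nat N).2 (h u)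
  let Q : ℕ → ProbabilityMeasure ℝ := fun n => ⟨μ n, hμ n⟩
  -- Continuity of the limit at `0` forces tightness, hence relative compactness; any cluster point
  -- of the laws has characteristic function `g`.
  have htight : IsTightMeasureSet (Set.range μ) := isTightMeasureSet_of_tendsto_charFun hg h'
  have hcompact : IsCompact (closure (Set.range Q)) := by
    refine isCompact_closure_of_isTightMeasureSet (htight.subset ?_)
    rintro _ ⟨_, ⟨n, rfl⟩, rfl⟩
    exact ⟨n, rfl⟩
  obtain ⟨Q₀, -, hQ₀⟩ := hcompact.exists_mapClusterPt (f := atTop) (u := Q)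
    (tendsto_principal.2 (.of_forall fun n => subset_closure ⟨n, rfl⟩))
  obtain ⟨U, hU, hUQ⟩ := mapClusterPt_iff_ultrafilter.1 hQ₀
  refine ⟨Q₀, inferInstance, funext fun u => tendsto_nhds_unique ((h' u).mono_left hU) ?_⟩
  rw [ProbabilityMeasure.tendsto_iff_forall_integral_rclike_tendsto ℂ] at hUQ
  simp_rw [charFun_eq_integral_innerProbChar]
  exact hUQ (BoundedContinuousFunction.innerProbChar u)

lemma charFun_real_eq (μ : Measure ℝ) (u : ℝ) :
    charFun μ u = ∫ x : ℝ, Complex.exp (Complex.I * u * x) ∂μ := by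
  rw [charFun_apply_real]
  congr 1 with x
  congr 1
  ring

lemma integrable_cexp_I_mul_mul (u : ℝ) (μ : Measure ℝ) [IsFiniteMeasure μ] :
    Integrable (fun x : ℝ => Complex.exp (Complex.I * u * x)) μ :=
  .of_bound (Continuous.aestronglyMeasurable (by fun_prop)) 1
    (.of_forall fun x => (norm_cexp_I_mul_mul u x).le)

/-- The characteristic function of a compound Poisson law. -/
lemma compoundPoisson_mem_charFunctions (μ : Measure ℝ) [IsFiniteMeasure μ] :
    (fun u : ℝ => Complex.exp (∫ x : ℝ, (Complex.exp (Complex.I * u * x) - 1) ∂μ)) ∈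
      charFunctions := by
  have hint : ∀ u : ℝ, ∫ x : ℝ, (Complex.exp (Complex.I * u * x) - 1) ∂μ =
      charFun μ u - μ.real Set.univ := fun u => by
    rw [integral_sub (integrable_cexp_I_mul_mul u μ) (integrable_const _), charFun_real_eq]
    simp
  simp_rw [hint]
  -- The `n`-th term is the characteristic function of the `n`-fold convolution of `(1 - m/n) δ₀ +
  -- μ/n`, where `m` is the mass of `μ`; this is a probability measure once `n ≥ m`.
  refine charFunctions_of_tendsto
    (f := fun n u => (1 + (charFun μ u - μ.real Set.univ) / n) ^ n) ?_ ?_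
    fun u => Complex.tendsto_one_add_div_pow_exp _
  · obtain ⟨N, hN⟩ := exists_nat_gt (μ.real Set.univ)
    filter_upwards [eventually_ge_atTop (max N 1)] with n hn
    have hn1 : 1 ≤ n := (le_max_right _ _).trans hn
    have hn0 : (0 : ℝ) < n := by exact_mod_cast hn1
    have hnμ : μ.real Set.univ ≤ n :=
      hN.le.trans (by exact_mod_cast (le_max_left _ _).trans hn)
    have hle : μ.real Set.univ / n ≤ 1 := (div_le_one hn0).2 hnμ
    refine charFunctions_pow (f := fun u => 1 + (charFun μ u - μ.real Set.univ) / n) ?_ n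
    have hfin : IsFiniteMeasure
        (ENNReal.ofReal (1 - μ.real Set.univ / n) • Measure.dirac (0 : ℝ)) :=
      Measure.smul_finite _ ENNReal.ofReal_ne_top
    have hfin' : IsFiniteMeasure (ENNReal.ofReal (1 / n) • μ) :=
      Measure.smul_finite _ ENNReal.ofReal_ne_top
    refine ⟨ENNReal.ofReal (1 - μ.real Set.univ / n) • Measure.dirac 0 +
      ENNReal.ofReal (1 / n) • μ, ⟨?_⟩, funext fun u => ?_⟩
    · rw [Measure.add_apply, Measure.smul_apply, Measure.smul_apply, measure_univ,
        ← ofReal_measureReal (μ := μ), smul_eq_mul, smul_eq_mul, mul_one,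
        ← ENNReal.ofReal_mul (by positivity), ← ENNReal.ofReal_add (by linarith) (by positivity)]
      rw [← ENNReal.ofReal_one]
      congr 1
      ring
    · symm
      rw [charFun_real_eq, integral_add_measure (integrable_cexp_I_mul_mul u _)
        (integrable_cexp_I_mul_mul u _), integral_smul_measure, integral_smul_measure,
        integral_dirac, ← charFun_real_eq, ENNReal.toReal_ofReal (by linarith),
        ENNReal.toReal_ofReal (by positivity)]
      simp
      ring
  · fun_prop

lemma gaussian_mem_charFunctions (v : ℝ≥0) :
    (fun u : ℝ => Complex.exp (-(v * u ^ 2 / 2))) ∈ charFunctions := by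
  refine ⟨gaussianReal 0 v, inferInstance, funext fun u => ?_⟩
  rw [charFun_gaussianReal]
  simp

/-- The exponential of the integral of the Lévy kernel away from the origin. -/
lemma exp_setIntegral_levyKernel_mem_charFunctions (μ : Measure ℝ) [IsFiniteMeasure μ] {ε : ℝ}
    (hε : 0 < ε) :
    (fun u : ℝ => Complex.exp (∫ x in {x : ℝ | ε < |x|}, levyKernel u x ∂μ)) ∈
      charFunctions := by
  set S : Set ℝ := {x : ℝ | ε < |x|}
  have hS : MeasurableSet S := measurableSet_lt measurable_const (by fun_prop)
  have hbound : ∀ x ∈ S, (1 + x ^ 2) / x ^ 2 ≤ 1 / ε ^ 2 + 1 := fun x hx => by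
    have h1 : ε ^ 2 ≤ x ^ 2 := by
      rw [← sq_abs x]; exact pow_le_pow_left₀ hε.le (le_of_lt hx) 2
    have h2 : 0 < x ^ 2 := (pow_pos hε 2).trans_le h1
    rw [add_div, div_self h2.ne']
    gcongr
  -- Away from `0` the kernel is `w(x)(e^{iux} - 1) - iu/x`: a compound Poisson exponent with jump
  -- measure `w μ`, plus a drift.
  let w : ℝ → ℝ≥0 := fun x => ((1 + x ^ 2) / x ^ 2).toNNReal
  have hw : Measurable w := by fun_prop
  let m : Measure ℝ := (μ.restrict S).withDensity fun x => w x
  have hm : IsFiniteMeasure m := by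
    refine isFiniteMeasure_withDensity (ne_top_of_le_ne_top (b :=
      ∫⁻ x in S, ENNReal.ofReal (1 / ε ^ 2 + 1) ∂μ) ?_ ?_)
    · rw [lintegral_const]
      exact ENNReal.mul_ne_top ENNReal.ofReal_ne_top (measure_ne_top _ _)
    · refine setLIntegral_mono measurable_const fun x hx => ?_
      exact ENNReal.ofReal_le_ofReal (hbound x hx)
  have hinv : Integrable (fun x : ℝ => (x : ℂ)⁻¹) (μ.restrict S) := by
    refine .of_bound (Measurable.aestronglyMeasurable (by fun_prop)) ε⁻¹ ?_
    filter_upwards [ae_restrict_mem hS] with x hx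
    rw [norm_inv, Complex.norm_real, Real.norm_eq_abs]
    exact inv_anti₀ hε (le_of_lt hx)
  have hinv' : ∫ x in S, (x : ℂ)⁻¹ ∂μ = ((∫ x in S, x⁻¹ ∂μ : ℝ) : ℂ) := by
    simp_rw [← Complex.ofReal_inv]
    exact integral_ofReal
  have key : ∀ u : ℝ, ∫ x in S, levyKernel u x ∂μ =
      ∫ x : ℝ, (Complex.exp (Complex.I * u * x) - 1) ∂m +
        Complex.I * u * ((-∫ x in S, x⁻¹ ∂μ : ℝ) : ℂ) := fun u => by
    have h : ∀ x ∈ S, levyKernel u x =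
        w x • (Complex.exp (Complex.I * u * x) - 1) - Complex.I * u * (x : ℂ)⁻¹ := fun x hx => by
      have hx0 : x ≠ 0 := by
        rintro rfl
        have : ε < |(0 : ℝ)| := hx
        simp at this
        linarith
      have hx' : (x : ℂ) ≠ 0 := by exact_mod_cast hx0
      rw [levyKernel, if_neg hx0, NNReal.smul_def, Real.coe_toNNReal _ (by positivity),
        Complex.real_smul]
      push_cast
      field_simp
    rw [setIntegral_congr_fun hS h, integral_sub, integral_const_mul, hinv',
      integral_withDensity_eq_integral_smul hw]
    · push_cast; ring
    · refine (integrable_withDensity_iff_integrable_smul hw).1 ?_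
      exact (integrable_cexp_I_mul_mul u m).sub (integrable_const _)
    · exact hinv.const_mul _
  simp_rw [key, Complex.exp_add]
  exact charFunctions_mul (compoundPoisson_mem_charFunctions m) (exp_drift_mem_charFunctions _)

/-- The atom of `μ` at `0` gives a Gaussian factor; the rest is a limit of compound Poisson laws
with drift, obtained by restricting `μ` to `|x| > 1/(n+1)`. Membership is needed both for the axioms
of `d` and for the tightness argument. -/
lemma levyPhi_mem_charFunctions (b : ℝ) (μ : FiniteMeasure ℝ) :
    levyPhi b μ ∈ charFunctions := by
  have hsplit : ∀ u : ℝ, ∫ x, levyKernel u x ∂(μ : Measure ℝ) =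
      -(((μ {0} : ℝ≥0) : ℂ) * u ^ 2 / 2) +
        ∫ x in {0}ᶜ, levyKernel u x ∂(μ : Measure ℝ) := fun u => by
    rw [← integral_add_compl (measurableSet_singleton 0) (integrable_levyKernel u _),
      integral_singleton]
    have h0 : (μ : Measure ℝ).real {0} = (μ {0} : ℝ≥0) := rfl
    rw [h0, levyKernel, if_pos rfl, Complex.real_smul]
    congr 1
    ring
  have hphi : levyPhi b μ = fun u : ℝ => (Complex.exp (Complex.I * u * b) *
      Complex.exp (-(((μ {0} : ℝ≥0) : ℂ) * u ^ 2 / 2))) *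
        Complex.exp (∫ x in {0}ᶜ, levyKernel u x ∂(μ : Measure ℝ)) := by
    ext u
    rw [levyPhi, hsplit, Complex.exp_add, Complex.exp_add]
    ring
  rw [hphi]
  refine charFunctions_mul
    (charFunctions_mul (exp_drift_mem_charFunctions b) (gaussian_mem_charFunctions _)) ?_
  refine charFunctions_of_tendsto
    (f := fun n u => Complex.exp
      (∫ x in {x : ℝ | 1 / ((n : ℝ) + 1) < |x|}, levyKernel u x ∂(μ : Measure ℝ)))
    (.of_forall fun n => exp_setIntegral_levyKernel_mem_charFunctions _ (by positivity)) ?_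
    fun u => (Complex.continuous_exp.tendsto _).comp ?_
  · exact (continuous_integral_levyKernel _).cexp.continuousAt
  · have hU : ({0}ᶜ : Set ℝ) = ⋃ n : ℕ, {x : ℝ | 1 / ((n : ℝ) + 1) < |x|} := by
      ext x
      simp only [Set.mem_compl_iff, Set.mem_singleton_iff, Set.mem_iUnion, Set.mem_ofPred_eq]
      refine ⟨fun hx => exists_nat_one_div_lt (abs_pos.2 hx), ?_⟩
      rintro ⟨n, hn⟩ rfl
      rw [abs_zero] at hn
      exact hn.not_ge (by positivity)
    rw [hU]
    refine tendsto_setIntegral_of_monotone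
      (fun n => measurableSet_lt measurable_const (by fun_prop)) ?_
      (integrable_levyKernel u _).integrableOn
    intro m n hmn x hx
    change 1 / ((m : ℝ) + 1) < |x| at hx
    exact (Nat.one_div_le_one_div hmn).trans_lt hx

/-! ### From interval integrals to locally uniform convergence -/

/-- A tail bound gives a modulus of continuity for the characteristic function. -/
lemma norm_charFun_sub_charFun_le (μ : Measure ℝ) [IsProbabilityMeasure μ] {K ε : ℝ} (hK : 0 ≤ K)
    (h : μ.real {x | K < |x|} ≤ ε) (u v : ℝ) :
    ‖charFun μ u - charFun μ v‖ ≤ K * |u - v| + 2 * ε := by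
  have hS : MeasurableSet {x : ℝ | K < |x|} := measurableSet_lt measurable_const (by fun_prop)
  have hg : Integrable (fun x => K * |u - v| + {x : ℝ | K < |x|}.indicator (fun _ => (2 : ℝ)) x) μ :=
    (integrable_const _).add ((integrable_const _).indicator hS)
  rw [charFun_real_eq, charFun_real_eq,
    ← integral_sub (integrable_cexp_I_mul_mul u μ) (integrable_cexp_I_mul_mul v μ)]
  calc _ ≤ ∫ x, (K * |u - v| + {x : ℝ | K < |x|}.indicator (fun _ => (2 : ℝ)) x) ∂μ := by
        refine norm_integral_le_of_norm_le hg (.of_forall fun x => ?_)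
        by_cases hx : K < |x|
        · rw [Set.indicator_of_mem (by exact hx)]
          refine (norm_sub_le _ _).trans ?_
          rw [norm_cexp_I_mul_mul, norm_cexp_I_mul_mul]
          have : 0 ≤ K * |u - v| := by positivity
          linarith
        · rw [Set.indicator_of_notMem (by exact hx), add_zero]
          have h1 : Complex.exp (Complex.I * u * x) - Complex.exp (Complex.I * v * x) =
              Complex.exp (Complex.I * v * x) *
                (Complex.exp (Complex.I * ((u - v) * x : ℝ)) - 1) := by
            rw [mul_sub, mul_one, ← Complex.exp_add]
            congr 2
            push_cast
            ring
          rw [h1, norm_mul, norm_cexp_I_mul_mul, one_mul]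
          refine Real.norm_exp_I_mul_ofReal_sub_one_le.trans ?_
          rw [Real.norm_eq_abs, abs_mul, mul_comm]
          exact mul_le_mul_of_nonneg_right (not_lt.1 hx) (abs_nonneg _)
    _ = K * |u - v| + 2 * μ.real {x : ℝ | K < |x|} := by
        rw [integral_add (integrable_const _) ((integrable_const _).indicator hS),
          integral_indicator hS]
        simp [mul_comm]
    _ ≤ _ := by linarith

/-- Convergence of the integrals of the characteristic functions over intervals implies
tightness. -/
lemma exists_tail_le_of_tendsto_integral_charFun {μ : ℕ → Measure ℝ}
    [∀ n, IsProbabilityMeasure (μ n)] {μ₀ : Measure ℝ} [IsProbabilityMeasure μ₀]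
    (h : ∀ s t : ℝ, Tendsto (fun n => ∫ u in s..t, charFun (μ n) u) atTop
      (𝓝 (∫ u in s..t, charFun μ₀ u))) {ε : ℝ} (hε : 0 < ε) :
    ∃ K > 0, (∀ᶠ n in atTop, (μ n).real {x | K < |x|} ≤ ε) ∧ μ₀.real {x | K < |x|} ≤ ε := by
  have hcont : ContinuousAt (charFun μ₀) 0 := continuous_charFun.continuousAt
  -- With `r = 4/δ` the integration interval is `[-δ/2, δ/2]`, and the tail bound for the limit law
  -- is at most `ε/2`. The strict inequality below `ε` passes to the approximating laws.
  obtain ⟨δ, hδ, hδ'⟩ := Metric.continuousAt_iff.1 hcont (ε / 4) (by positivity)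
  set r : ℝ := 4 / δ
  have hr : 0 < r := by positivity
  have hrδ : 2 * r⁻¹ = δ / 2 := by simp only [r]; field_simp; norm_num
  have hint (m : Measure ℝ) [IsProbabilityMeasure m] (a b : ℝ) :
      ∫ t in a..b, 1 - charFun m t = (∫ t in a..b, (1 : ℂ)) - ∫ t in a..b, charFun m t :=
    intervalIntegral.integral_sub (by simp) intervalIntegrable_charFun
  have hB : 2⁻¹ * r * ‖∫ t in (-2 * r⁻¹)..(2 * r⁻¹), 1 - charFun μ₀ t‖ < ε := by
    have h1 : ‖∫ t in (-2 * r⁻¹)..(2 * r⁻¹), 1 - charFun μ₀ t‖ ≤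
        ε / 4 * |2 * r⁻¹ - -2 * r⁻¹| := by
      refine intervalIntegral.norm_integral_le_of_norm_le_const fun t ht => ?_
      rw [neg_mul, hrδ, Set.uIoc_of_le (by linarith)] at ht
      have ht' : |t| < δ := abs_lt.2 ⟨by linarith [ht.1], by linarith [ht.2]⟩
      have := hδ' (x := t) (by simpa [Real.dist_eq] using ht')
      rw [dist_comm, dist_eq_norm] at this
      simpa using this.le
    have h2 : |2 * r⁻¹ - -2 * r⁻¹| = 4 * r⁻¹ := by
      rw [abs_of_nonneg] <;> [ring; (ring_nf; positivity)]
    rw [h2] at h1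
    calc _ ≤ 2⁻¹ * r * (ε / 4 * (4 * r⁻¹)) := by gcongr
      _ = ε / 2 := by field_simp
      _ < ε := by linarith
  refine ⟨r, hr, ?_, (measureReal_abs_gt_le_integral_charFun hr).trans hB.le⟩
  have hlim : Tendsto (fun n => 2⁻¹ * r * ‖∫ t in (-2 * r⁻¹)..(2 * r⁻¹), 1 - charFun (μ n) t‖)
      atTop (𝓝 (2⁻¹ * r * ‖∫ t in (-2 * r⁻¹)..(2 * r⁻¹), 1 - charFun μ₀ t‖)) := by
    simp_rw [hint]
    exact ((tendsto_const_nhds.sub (h _ _)).norm).const_mul _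
  filter_upwards [hlim.eventually_lt_const hB] with n hn
  exact (measureReal_abs_gt_le_integral_charFun hr).trans hn.le

/-- Uniform tails make each function vary little on a short interval, so its value is close to its
average there, and the averages converge. -/
lemma tendstoLocallyUniformly_charFun_of_tendsto_integral {μ : ℕ → Measure ℝ}
    [∀ n, IsProbabilityMeasure (μ n)] {μ₀ : Measure ℝ} [IsProbabilityMeasure μ₀]
    (h : ∀ s t : ℝ, Tendsto (fun n => ∫ u in s..t, charFun (μ n) u) atTop
      (𝓝 (∫ u in s..t, charFun μ₀ u))) :
    TendstoLocallyUniformly (fun n => charFun (μ n)) (charFun μ₀) atTop := by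
  rw [Metric.tendstoLocallyUniformly_iff]
  intro ε hε c
  obtain ⟨K, hK, hn, h0⟩ := exists_tail_le_of_tendsto_integral_charFun h
    (ε := ε / 10) (by positivity)
  -- For points at distance at most `2δ` the modulus is `2Kδ + 2ε/10 = 4ε/10`. It is used twice, and
  -- the averages add `ε/10`: in total `9ε/10 < ε`.
  set δ : ℝ := ε / 10 / K
  have hδ : 0 < δ := by positivity
  have hKδ : K * δ = ε / 10 := by simp only [δ]; field_simp
  have havg (m : Measure ℝ) [IsProbabilityMeasure m] (hm : m.real {x | K < |x|} ≤ ε / 10)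
      (v : ℝ) (hv : |v - c| < δ) :
      ‖δ * charFun m v - ∫ t in c..c + δ, charFun m t‖ ≤ 4 * (ε / 10) * δ := by
    have h1 : (δ : ℂ) * charFun m v - ∫ t in c..c + δ, charFun m t =
        ∫ t in c..c + δ, (charFun m v - charFun m t) := by
      rw [intervalIntegral.integral_sub (by simp) intervalIntegrable_charFun]
      simp
    have h2 : |c + δ - c| = δ := by rw [add_sub_cancel_left, abs_of_pos hδ]
    rw [h1]
    refine (intervalIntegral.norm_integral_le_of_norm_le_const (C := 4 * (ε / 10))
      fun t ht => ?_).trans_eq (by rw [h2])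
    rw [Set.uIoc_of_le (by linarith)] at ht
    refine (norm_charFun_sub_charFun_le m hK.le hm v t).trans ?_
    have h3 : |v - t| ≤ 2 * δ := by
      have := abs_lt.1 hv
      exact abs_le.2 ⟨by linarith [ht.2], by linarith [ht.1]⟩
    have := mul_le_mul_of_nonneg_left h3 hK.le
    linarith
  refine ⟨Metric.ball c δ, Metric.ball_mem_nhds c hδ, ?_⟩
  have hclose := (Metric.tendsto_nhds.1 (h c (c + δ))) (ε / 10 * δ) (by positivity)
  filter_upwards [hn, hclose] with n hn hclose v hv
  rw [Metric.mem_ball, Real.dist_eq] at hv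
  rw [dist_eq_norm] at hclose ⊢
  have h1 := havg μ₀ h0 v hv
  have h2 := havg (μ n) hn v hv
  have h3 : δ * ‖charFun μ₀ v - charFun (μ n) v‖ =
      ‖(δ * charFun μ₀ v - ∫ t in c..c + δ, charFun μ₀ t) -
        (δ * charFun (μ n) v - ∫ t in c..c + δ, charFun (μ n) t) -
        ((∫ t in c..c + δ, charFun (μ n) t) - ∫ t in c..c + δ, charFun μ₀ t)‖ := by
    rw [← abs_of_pos hδ, ← Real.norm_eq_abs, ← Complex.norm_real, ← norm_mul, Complex.norm_real,
      Real.norm_eq_abs, abs_of_pos hδ]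
    congr 1
    ring
  have h4 := (norm_sub_le (δ * charFun μ₀ v - (∫ t in c..c + δ, charFun μ₀ t) -
        (δ * charFun (μ n) v - ∫ t in c..c + δ, charFun (μ n) t))
        ((∫ t in c..c + δ, charFun (μ n) t) - ∫ t in c..c + δ, charFun μ₀ t)).trans
      (add_le_add_left (norm_sub_le _ _) _)
  rw [← h3] at h4
  refine lt_of_mul_lt_mul_left (a := δ) ?_ hδ.le
  nlinarith

/-! ### From characteristic functions to exponents -/

/-- Locally uniform convergence of exponentials lifts to the exponents normalised at `0`. -/
lemma eventually_norm_sub_lt_of_tendstoLocallyUniformly_exp {ψ : ℕ → ℝ → ℂ} {ψ₀ : ℝ → ℂ}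
    (hψ : ∀ n, Continuous (ψ n)) (hψ₀ : Continuous ψ₀) (h0 : ∀ n, ψ n 0 = 0) (h0' : ψ₀ 0 = 0)
    (h : TendstoLocallyUniformly (fun n u => Complex.exp (ψ n u)) (fun u => Complex.exp (ψ₀ u))
      atTop) {T ε : ℝ} (hT : 0 ≤ T) (hε : 0 < ε) :
    ∀ᶠ n in atTop, ∀ u ∈ Set.Icc (-T) T, ‖ψ n u - ψ₀ u‖ < ε := by
  have hlog : ContinuousAt Complex.log 1 := continuousAt_clog (by simp)
  obtain ⟨δ, hδ, hδ'⟩ := Metric.continuousAt_iff.1 hlog ε hε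
  obtain ⟨M, hM⟩ := isCompact_Icc.exists_bound_of_continuousOn (s := Set.Icc (-T) T)
    (f := fun u => Complex.exp (-ψ₀ u)) (by fun_prop)
  have hM0 : 0 ≤ M := (norm_nonneg _).trans (hM 0 ⟨by linarith, hT⟩)
  have hunif := (tendstoLocallyUniformlyOn_iff_tendstoUniformlyOn_of_compact
    (isCompact_Icc (a := -T) (b := T))).1 (tendstoLocallyUniformlyOn_univ.2 h |>.mono
      (Set.subset_univ _))
  rw [Metric.tendstoUniformlyOn_iff] at hunif
  filter_upwards [hunif (min δ 1 / (M + 1)) (by positivity)] with n hn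
  have hexp : ∀ u ∈ Set.Icc (-T) T, ‖Complex.exp (ψ n u - ψ₀ u) - 1‖ < min δ 1 := fun u hu => by
    have h1 : Complex.exp (ψ n u - ψ₀ u) - 1 =
        (Complex.exp (ψ n u) - Complex.exp (ψ₀ u)) * Complex.exp (-ψ₀ u) := by
      rw [sub_mul, ← Complex.exp_add, ← Complex.exp_add]; simp [sub_eq_add_neg]
    have h2 := hn u hu
    rw [dist_comm, dist_eq_norm, lt_div_iff₀ (by positivity)] at h2
    rw [h1, norm_mul]
    refine lt_of_le_of_lt ?_ h2
    exact mul_le_mul_of_nonneg_left ((hM u hu).trans (by linarith)) (norm_nonneg _)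
  -- The imaginary part starts at `0`. To leave the principal branch it would have to reach `±π`,
  -- where the exponential is a negative real, at distance more than `1` from `1`.
  have him : ∀ u ∈ Set.Icc (-T) T, |(ψ n u - ψ₀ u).im| < Real.pi := by
    by_contra! hcon
    obtain ⟨u, hu, hpi⟩ := hcon
    have hc : ContinuousOn (fun u => |(ψ n u - ψ₀ u).im|) (Set.Icc (-T) T) :=
      (Complex.continuous_im.comp ((hψ n).sub hψ₀)).abs.continuousOn
    obtain ⟨v, hv, hv'⟩ := isPreconnected_Icc.intermediate_value (a := 0) (b := u)
      ⟨by linarith, hT⟩ hu hc ⟨by simp [h0, h0', Real.pi_pos.le], hpi⟩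
    have h1 : Real.cos (ψ n v - ψ₀ v).im = -1 := by
      change |(ψ n v - ψ₀ v).im| = Real.pi at hv'
      rw [← Real.cos_abs, hv', Real.cos_pi]
    have h2 := (Complex.abs_re_le_norm _).trans_lt (hexp v hv)
    rw [Complex.sub_re, Complex.exp_re, h1, Complex.one_re] at h2
    have h3 := h2.trans_le (min_le_right δ 1)
    have := Real.exp_pos (ψ n v - ψ₀ v).re
    have := (abs_lt.1 h3).1
    linarith
  intro u hu
  have h1 := abs_lt.1 (him u hu)
  have h2 := hδ' (x := Complex.exp (ψ n u - ψ₀ u))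
    (by rw [dist_eq_norm]; exact (hexp u hu).trans_le (min_le_left _ _))
  rwa [Complex.log_exp h1.1 h1.2.le, Complex.log_one, dist_zero_right] at h2

/-! ### Recovering the measure and the drift -/

/-- Lévy's convergence theorem for finite measures on the line. -/
lemma FiniteMeasure.tendsto_of_tendsto_charFun {μ : ℕ → FiniteMeasure ℝ} {μ₀ : FiniteMeasure ℝ}
    (h : ∀ u : ℝ, Tendsto (fun n => charFun (μ n : Measure ℝ) u) atTop
      (𝓝 (charFun (μ₀ : Measure ℝ) u))) :
    Tendsto μ atTop (𝓝 μ₀) := by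
  have hmass : Tendsto (fun n => (μ n).mass) atTop (𝓝 μ₀.mass) := by
    have h0 := h 0
    simp only [charFun_zero] at h0
    have h1 := (Complex.continuous_re.tendsto _).comp h0
    exact NNReal.tendsto_coe.1 h1
  -- The zero measure cannot be normalised; in that case convergence of the masses suffices.
  by_cases h0 : μ₀ = 0
  · subst h0
    rw [FiniteMeasure.zero_mass] at hmass
    exact FiniteMeasure.tendsto_zero_of_tendsto_zero_mass hmass
  refine FiniteMeasure.tendsto_of_tendsto_normalize_testAgainstNN_of_tendsto_mass ?_ hmass
  have hm0 : μ₀.mass ≠ 0 := μ₀.mass_nonzero_iff.2 h0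
  have hnorm : ∀ m : FiniteMeasure ℝ, m ≠ 0 → ∀ u : ℝ,
      charFun (m.normalize : Measure ℝ) u = ((m.mass⁻¹ : ℝ≥0) : ℂ) * charFun (m : Measure ℝ) u := by
    intro m hm u
    rw [m.toMeasure_normalize_eq_of_nonzero hm, charFun_apply, charFun_apply,
      integral_smul_nnreal_measure, NNReal.smul_def, Complex.real_smul]
  refine ProbabilityMeasure.tendsto_of_tendsto_charFun fun u => ?_
  rw [hnorm μ₀ h0]
  have hinv : Tendsto (fun n => (((μ n).mass⁻¹ : ℝ≥0) : ℂ)) atTop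
      (𝓝 ((μ₀.mass⁻¹ : ℝ≥0) : ℂ)) :=
    ((Complex.continuous_ofReal.comp NNReal.continuous_coe).tendsto _).comp (hmass.inv₀ hm0)
  refine (hinv.mul (h u)).congr' ?_
  filter_upwards [hmass.eventually_ne hm0] with n hn
  rw [hnorm _ ((μ n).mass_nonzero_iff.1 hn)]

/-- The measure `(1 - sin x / x)(1 + x²)/x² μ(dx)`. -/
noncomputable def levyWeighted (μ : FiniteMeasure ℝ) : FiniteMeasure ℝ :=
  ⟨(μ : Measure ℝ).withDensity fun x => ((levyWeight x).toNNReal : ℝ≥0∞), by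
    refine isFiniteMeasure_withDensity (ne_top_of_le_ne_top (b := ∫⁻ _, 3 ∂(μ : Measure ℝ)) ?_ ?_)
    · rw [lintegral_const]
      exact ENNReal.mul_ne_top (by simp) (measure_ne_top _ _)
    · refine lintegral_mono fun x => ?_
      exact (ENNReal.ofReal_le_ofReal (levyWeight_le x)).trans_eq (by simp)⟩

lemma integral_levyWeighted {E : Type*} [NormedAddCommGroup E] [NormedSpace ℝ E]
    (μ : FiniteMeasure ℝ) (f : ℝ → E) :
    ∫ x, f x ∂(levyWeighted μ : Measure ℝ) = ∫ x, levyWeight x • f x ∂(μ : Measure ℝ) := by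
  have h : (levyWeighted μ : Measure ℝ) =
      (μ : Measure ℝ).withDensity fun x => ((levyWeight x).toNNReal : ℝ≥0∞) := rfl
  rw [h, integral_withDensity_eq_integral_smul continuous_levyWeight.measurable.real_toNNReal]
  congr 1 with x
  rw [NNReal.smul_def, Real.coe_toNNReal _ (levyWeight_pos x).le]

lemma charFun_levyWeighted (b : ℝ) (μ : FiniteMeasure ℝ) (u : ℝ) :
    charFun (levyWeighted μ : Measure ℝ) u =
      levyExponent b μ u - (1 / 2) * ∫ s in (-1 : ℝ)..1, levyExponent b μ (u + s) := by
  rw [levyExponent_sub_average, charFun_real_eq, integral_levyWeighted]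
  simp_rw [Complex.real_smul, mul_comm]

/-- Since the weight is continuous and bounded below by a positive constant, `f / levyWeight` is
again a bounded continuous test function. -/
lemma tendsto_of_tendsto_levyWeighted {μ : ℕ → FiniteMeasure ℝ} {μ₀ : FiniteMeasure ℝ}
    (h : Tendsto (fun n => levyWeighted (μ n)) atTop (𝓝 (levyWeighted μ₀))) :
    Tendsto μ atTop (𝓝 μ₀) := by
  rw [FiniteMeasure.tendsto_iff_forall_integral_tendsto] at h ⊢
  intro f
  obtain ⟨c, hc, hcw⟩ := exists_le_levyWeight
  let g : BoundedContinuousFunction ℝ ℝ := .ofNormedAddCommGroup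
    (fun x => (levyWeight x)⁻¹ * f x)
    ((continuous_levyWeight.inv₀ fun x => (levyWeight_pos x).ne').mul f.continuous)
    (c⁻¹ * ‖f‖) fun x => by
      rw [norm_mul, norm_inv, Real.norm_eq_abs, abs_of_pos (levyWeight_pos x)]
      exact mul_le_mul (inv_anti₀ hc (hcw x)) (f.norm_coe_le_norm x) (norm_nonneg _)
        (by positivity)
  have hg : ∀ m : FiniteMeasure ℝ, ∫ x, g x ∂(levyWeighted m : Measure ℝ) =
      ∫ x, f x ∂(m : Measure ℝ) := fun m => by
    rw [integral_levyWeighted]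
    congr 1 with x
    exact mul_inv_cancel_left₀ (levyWeight_pos x).ne' (f x)
  simpa only [hg] using h g

/-- If the Lévy–Khintchine exponents converge locally uniformly, then so do the parameters. -/
lemma tendsto_of_tendsto_levyExponent {b : ℕ → ℝ} {μ : ℕ → FiniteMeasure ℝ} {b₀ : ℝ}
    {μ₀ : FiniteMeasure ℝ}
    (h : ∀ T ≥ 0, ∀ ε > 0, ∀ᶠ n in atTop, ∀ u ∈ Set.Icc (-T) T,
      ‖levyExponent (b n) (μ n) u - levyExponent b₀ μ₀ u‖ < ε) :
    Tendsto b atTop (𝓝 b₀) ∧ Tendsto μ atTop (𝓝 μ₀) := by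
  have hpt : ∀ u : ℝ, Tendsto (fun n => levyExponent (b n) (μ n) u) atTop
      (𝓝 (levyExponent b₀ μ₀ u)) := fun u => by
    rw [Metric.tendsto_nhds]
    intro ε hε
    filter_upwards [h |u| (abs_nonneg u) ε hε] with n hn
    rw [dist_eq_norm]
    exact hn u ⟨neg_abs_le u, le_abs_self u⟩
  have hμ : Tendsto μ atTop (𝓝 μ₀) := by
    refine tendsto_of_tendsto_levyWeighted (FiniteMeasure.tendsto_of_tendsto_charFun fun u => ?_)
    simp_rw [charFun_levyWeighted b₀ μ₀, fun n => charFun_levyWeighted (b n) (μ n)]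
    refine (hpt u).sub (Tendsto.const_mul _ ?_)
    rw [Metric.tendsto_nhds]
    intro ε hε
    -- The points `u + s` with `|s| ≤ 1` stay in `[-(|u|+1), |u|+1]`, and an interval of length `2`
    -- turns `ε/3` into `2ε/3`.
    filter_upwards [h (|u| + 1) (by positivity) (ε / 3) (by positivity)] with n hn
    have hint (b' : ℝ) (m : FiniteMeasure ℝ) :
        IntervalIntegrable (fun s => levyExponent b' m (u + s)) volume (-1) 1 :=
      ((continuous_levyExponent b' m).comp (continuous_const_add u)).intervalIntegrable _ _
    rw [dist_eq_norm, ← intervalIntegral.integral_sub (hint _ _) (hint _ _)]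
    refine (intervalIntegral.norm_integral_le_of_norm_le_const (C := ε / 3)
      fun s hs => (hn (u + s) ?_).le).trans_lt ?_
    · rw [Set.uIoc_of_le (by norm_num)] at hs
      exact ⟨by linarith [neg_abs_le u, hs.1], by linarith [le_abs_self u, hs.2]⟩
    · norm_num; linarith
  refine ⟨?_, hμ⟩
  -- The kernel at `u = 1` is a bounded continuous test function; subtracting its integral from the
  -- exponent leaves `i b`.
  let k : BoundedContinuousFunction ℝ ℂ := .ofNormedAddCommGroup (levyKernel 1)
    (continuous_levyKernel_right 1) _ (norm_levyKernel_le 1)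
  have hk := (FiniteMeasure.tendsto_iff_forall_integral_rclike_tendsto ℂ).1 hμ k
  have hb : ∀ (b' : ℝ) (m : FiniteMeasure ℝ),
      (levyExponent b' m 1 - ∫ x, k x ∂(m : Measure ℝ)).im = b' := fun b' m => by
    have : levyExponent b' m 1 - ∫ x, k x ∂(m : Measure ℝ) = Complex.I * b' := by
      simp only [levyExponent, Complex.ofReal_one, mul_one]
      exact add_sub_cancel_right _ _
    rw [this]; simp
  have hlim := (Complex.continuous_im.tendsto _).comp ((hpt 1).sub hk)
  simpa only [Function.comp_def, hb] using hlim

/-- Convergence of the integrals of infinitely divisible characteristic functions over intervals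
implies convergence of the parameters. -/
lemma tendsto_of_tendsto_integral_levyPhi {b : ℕ → ℝ} {μ : ℕ → FiniteMeasure ℝ} {b₀ : ℝ}
    {μ₀ : FiniteMeasure ℝ}
    (h : ∀ s t : ℝ, Tendsto (fun n => ∫ u in s..t, levyPhi (b n) (μ n) u) atTop
      (𝓝 (∫ u in s..t, levyPhi b₀ μ₀ u))) :
    Tendsto b atTop (𝓝 b₀) ∧ Tendsto μ atTop (𝓝 μ₀) := by
  choose Q hQ hQφ using fun n => levyPhi_mem_charFunctions (b n) (μ n)
  obtain ⟨Q₀, hQ₀, hQ₀φ⟩ := levyPhi_mem_charFunctions b₀ μ₀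
  simp_rw [hQφ, hQ₀φ] at h
  have hunif := tendstoLocallyUniformly_charFun_of_tendsto_integral h
  simp_rw [← hQφ, ← hQ₀φ] at hunif
  exact tendsto_of_tendsto_levyExponent fun T hT ε hε =>
    eventually_norm_sub_lt_of_tendstoLocallyUniformly_exp
      (fun n => continuous_levyExponent _ _) (continuous_levyExponent _ _)
      (fun n => levyExponent_zero _ _) (levyExponent_zero _ _) hunif hT hε

/-! ### The minimum distance estimator -/

lemma empiricalCharFun_mem_charFunctions {Ω : Type*} (X : ℝ≥0 → Ω → ℝ) {n : ℕ} (hn : 1 ≤ n)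
    (ω : Ω) : empiricalCharFun X n ω ∈ charFunctions := by
  have hn0 : (n : ℝ≥0∞) ≠ 0 := by exact_mod_cast (Nat.one_le_iff_ne_zero.1 hn)
  refine ⟨(n : ℝ≥0∞)⁻¹ • ∑ k ∈ Finset.range n,
    Measure.dirac (X ((k : ℝ≥0) + 1) ω - X (k : ℝ≥0) ω), ⟨?_⟩, funext fun u => ?_⟩
  · simp [ENNReal.inv_mul_cancel hn0 (ENNReal.natCast_ne_top n)]
  · rw [charFun_real_eq, integral_smul_measure,
      integral_finsetSum_measure fun k _ => integrable_cexp_I_mul_mul u _]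
    simp [empiricalCharFun, integral_dirac]

theorem theorem3p1 {Ω : Type*} [MeasurableSpace Ω] (P : Measure Ω) [IsProbabilityMeasure P]
    -- the observed Lévy process and its true characteristics
    (X : ℝ≥0 → Ω → ℝ) (hX : IsLevyProcess P X)
    (b σ : ℝ) (hσ : 0 ≤ σ) (ν : Measure ℝ) (hν : IsJumpMeasure ν)
    (hT : HasTriplet P X b σ ν)
    -- the distance
    (d : (ℝ → ℂ) → (ℝ → ℂ) → ℝ≥0∞) (hd : IsDistanceOn charFunctions d)
    -- consistency of the empirical characteristic function in `d`
    (hd_emp : ∀ᵐ ω ∂P, Tendsto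
      (fun n : ℕ => d (empiricalCharFun X n ω) (levyPhi b (nuSigma σ ν hν))) atTop (𝓝 0))
    -- convergence in `d` implies convergence of the integrals over intervals
    (hd_int : ∀ (b' : ℕ → ℝ) (μ' : ℕ → FiniteMeasure ℝ),
      Tendsto (fun n => d (levyPhi (b' n) (μ' n)) (levyPhi b (nuSigma σ ν hν))) atTop (𝓝 0) →
      ∀ s t : ℝ, Tendsto (fun n => ∫ u in s..t, levyPhi (b' n) (μ' n) u) atTop
        (𝓝 (∫ u in s..t, levyPhi b (nuSigma σ ν hν) u)))
    -- the approximate minimum distance fit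
    (δ : ℕ → ℝ) (hδ_pos : ∀ n, 1 ≤ n → 0 < δ n) (hδ : Tendsto δ atTop (𝓝 0))
    (bHat : ℕ → Ω → ℝ) (nuHat : ℕ → Ω → FiniteMeasure ℝ)
    (hfit : ∀ᵐ ω ∂P, ∀ n : ℕ, 1 ≤ n →
      d (empiricalCharFun X n ω) (levyPhi (bHat n ω) (nuHat n ω)) ≤
        (⨅ (b' : ℝ) (μ' : FiniteMeasure ℝ), d (empiricalCharFun X n ω) (levyPhi b' μ')) +
          ENNReal.ofReal (δ n)) :
    ∀ᵐ ω ∂P, Tendsto (fun n => bHat n ω) atTop (𝓝 b) ∧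
      Tendsto (fun n => nuHat n ω) atTop (𝓝 (nuSigma σ ν hν)) := by
  set φ₀ := levyPhi b (nuSigma σ ν hν)
  filter_upwards [hd_emp, hfit] with ω hemp hω
  refine tendsto_of_tendsto_integral_levyPhi
    (hd_int (fun n => bHat n ω) (fun n => nuHat n ω) ?_)
  have hδ' : Tendsto (fun n => ENNReal.ofReal (δ n)) atTop (𝓝 0) := by
    simpa using ENNReal.tendsto_ofReal hδ
  have hlim : Tendsto (fun n => d (empiricalCharFun X n ω) φ₀ + ENNReal.ofReal (δ n) +
      d (empiricalCharFun X n ω) φ₀) atTop (𝓝 0) := by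
    simpa using (hemp.add hδ').add hemp
  refine tendsto_of_tendsto_of_tendsto_of_le_of_le' tendsto_const_nhds hlim
    (.of_forall fun _ => zero_le) ?_
  -- For `n = 0` the empirical function is identically `0`, not a characteristic function, so the
  -- axioms of `d` do not apply to it.
  filter_upwards [eventually_ge_atTop 1] with n hn
  have he := empiricalCharFun_mem_charFunctions X hn ω
  have hf := levyPhi_mem_charFunctions (bHat n ω) (nuHat n ω)
  refine (hd.triangle _ hf _ he _ (levyPhi_mem_charFunctions _ _)).trans ?_
  rw [hd.symm _ hf _ he]
  gcongr
  -- The infimum is bounded by its value at the true parameters.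
  exact (hω n hn).trans (add_le_add_left (iInf₂_le _ _) _)
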